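/- Let $K\ge 2$ and consider a $K$-armed bandit whose arms all have the same reward distribution $\nu$, where $\nu$ is $1$-sub-Gaussian (that is, $\mathbb E\,e^{\lambda (X-\mathbb EX)}\le e^{\lambda^2/2}$ for all $\lambda\in\mathbb R$, $X\sim\nu$) and has positive variance; all rewards are independent. Write $n_{a,t}$ and $\widehat\mu_{a,t}$ for the number of pulls and the sample mean of arm $a$ after $t$ rounds. For every horizon $T$ let an optimism-based rule be given: it pulls each arm once in the first $K$ rounds, and afterwards $A_{t+1}\in\arg\max_{a}U_a(t)$, ties being broken uniformly at random, independently of everything else. The index $U_a(t)$ may depend on $T$. Assume that all arms are treated alike (relabelling the arms relabels the indices) and that, for every $T\ge1$, (A1) $U_a(t)$ is a (measurable) function of $(\widehat\mu_{b,t})_{b}$ and $(n_{b,t})_{b}$; (A2) if arm $a$ is not pulled in round $t$, where $K<t\le T$, then $U_a(t)\le U_a(t-1)$ (almost surely); (A3) almost surely on the event $\mathcal E_T=\{\,n_{a,\lfloor T/2K\rfloor}\in[\tfrac{T}{4K^2},\tfrac{3T}{4K^2}]\ \text{for all } a\,\}$ one has $$\widehat\mu_{a,t}+\frac{\beta_1}{\sqrt{n_{a,t}}}\le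 U_a(t)\le \widehat\mu_{a,t}+\frac{\beta_2}{\sqrt{n_{a,t}}}\qquad\text{for all arms } a \text{ and all } \lfloor T/2K\rfloor\le t\le T,$$ with real constants $\beta_1,\beta_2$ that do not depend on $T$. Say that the pull counts are (Lai–Wei) stable at times $\tau(T)$ if for every arm $a$ there are non-random $n^*_{a,T}\to\infty$ such that $n_{a,\tau(T)}/n^*_{a,T}\to1$ in probability as $T\to\infty$, where $n_{a,\tau(T)}$ is taken in the run with horizon $T$. Then the rule is unstable: 1. If the indices do not depend on the horizon $T$, the pull counts are not stable at times $T$. 2. For indices that may depend on the horizon, the pull counts are not stable both at times $\lfloor T/2K\rfloor$ and at times $T$. 3. If the pull counts are stable at times $\lfloor T/2K\rfloor$, then for each arm $a$ there is $p>0$ such that, for all large $T$, with probability at least $p$ arm $a$ is pulled in every round $t$ with $\lfloor T/2K\rfloor<t\le T$. -/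

import Mathlib

open MeasureTheory ProbabilityTheory Filter Topology
open scoped ENNReal NNReal

namespace Bandit

/-- An index rule for `K` arms: from the vector of sample means and the vector of pull counts it
computes the index `U_a` of every arm `a`. The current time is the sum of the counts, so an index
may depend on time as well. -/
abbrev IndexRule (K : ℕ) : Type := (Fin K → ℝ) → (Fin K → ℕ) → Fin K → ℝ

/-- The indices are measurable functions of the sample means. -/
def IsMeasurableRule {K : ℕ} (U : IndexRule K) : Prop :=
  ∀ (n : Fin K → ℕ) (a : Fin K), Measurable fun m : Fin K → ℝ => U m n a

/-- The rule treats all arms alike: relabelling the arms relabels the indices. -/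
def IsSymmetricRule {K : ℕ} (U : IndexRule K) : Prop :=
  ∀ (σ : Equiv.Perm (Fin K)) (m : Fin K → ℝ) (n : Fin K → ℕ) (a : Fin K),
    U (m ∘ σ) (n ∘ σ) a = U m n (σ a)

/-- The average of the first `n` entries of a reward sequence. -/
noncomputable def sampleMean (x : ℕ → ℝ) (n : ℕ) : ℝ :=
  (∑ i ∈ Finset.range n, x i) / n

open Classical in
/-- The set of arms of maximal index. -/
noncomputable def argmaxSet {K : ℕ} (u : Fin K → ℝ) : Finset (Fin K) :=
  Finset.univ.filter fun a => ∀ b, u b ≤ u a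

theorem argmaxSet_nonempty {K : ℕ} [NeZero K] (u : Fin K → ℝ) : (argmaxSet u).Nonempty := by
  obtain ⟨a, ha⟩ := Finite.exists_max u
  exact ⟨a, by simpa [argmaxSet] using ha⟩

/-- The arm of maximal index whose rank `r a` is smallest. For a uniformly random ranking `r` this
is a uniformly random element of the argmax. -/
noncomputable def pick {K : ℕ} [NeZero K] (u : Fin K → ℝ) (r : Equiv.Perm (Fin K)) : Fin K :=
  r.symm (((argmaxSet u).map r.toEmbedding).min' ((argmaxSet_nonempty u).map))

/-- The arm pulled in round `t + 1`, when `n` is the vector of pull counts after `t` rounds, `x a i`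
is the reward returned by the `(i+1)`-st pull of arm `a`, and `r` is the ranking that breaks ties.
The first `K` rounds pull each arm once; every later round pulls an arm of maximal index. -/
noncomputable def nextArm {K : ℕ} [NeZero K] (U : IndexRule K) (x : Fin K → ℕ → ℝ)
    (r : Equiv.Perm (Fin K)) (t : ℕ) (n : Fin K → ℕ) : Fin K :=
  if h : t < K then ⟨t, h⟩ else pick (U (fun a => sampleMean (x a) (n a)) n) r

/-- The vector of pull counts `n_{a,t}` after `t` rounds. -/
noncomputable def counts {K : ℕ} [NeZero K] (U : IndexRule K) (x : Fin K → ℕ → ℝ)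
    (r : ℕ → Equiv.Perm (Fin K)) : ℕ → Fin K → ℕ
  | 0 => fun _ => 0
  | t + 1 => fun a =>
      counts U x r t a + if nextArm U x (r t) t (counts U x r t) = a then 1 else 0

/-- The arm pulled in round `t + 1`. -/
noncomputable def action {K : ℕ} [NeZero K] (U : IndexRule K) (x : Fin K → ℕ → ℝ)
    (r : ℕ → Equiv.Perm (Fin K)) (t : ℕ) : Fin K :=
  nextArm U x (r t) t (counts U x r t)

/-- The sample mean of arm `a` after `t` rounds. -/
noncomputable def armMean {K : ℕ} [NeZero K] (U : IndexRule K) (x : Fin K → ℕ → ℝ)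
    (r : ℕ → Equiv.Perm (Fin K)) (t : ℕ) (a : Fin K) : ℝ :=
  sampleMean (x a) (counts U x r t a)

/-- The index `U_a(t)` of arm `a` after `t` rounds. -/
noncomputable def armIndex {K : ℕ} [NeZero K] (U : IndexRule K) (x : Fin K → ℕ → ℝ)
    (r : ℕ → Equiv.Perm (Fin K)) (t : ℕ) (a : Fin K) : ℝ :=
  U (armMean U x r t) (counts U x r t) a

instance instMeasurableSpacePerm (K : ℕ) : MeasurableSpace (Equiv.Perm (Fin K)) := ⊤

/-- A `K`-armed bandit environment whose arms all have reward distribution `ν`: `X a i` is the reward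
of the `(i+1)`-st pull of arm `a`, and `ρ t` is the ranking of the arms that breaks ties after `t`
rounds. All rewards have law `ν`, all rankings are uniform, and everything is independent. -/
structure IsEnvironment {Ω : Type*} [MeasurableSpace Ω] {K : ℕ} (P : Measure Ω) (ν : Measure ℝ)
    (X : Fin K → ℕ → Ω → ℝ) (ρ : ℕ → Ω → Equiv.Perm (Fin K)) : Prop where
  measurable_reward : ∀ a i, Measurable (X a i)
  law_reward : ∀ a i, P.map (X a i) = ν
  indep_reward : iIndepFun (fun (p : Fin K × ℕ) ω => X p.1 p.2 ω) P
  measurable_rank : ∀ t, Measurable (ρ t)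
  law_rank : ∀ t, P.map (ρ t) = (PMF.uniformOfFintype (Equiv.Perm (Fin K))).toMeasure
  indep_rank : iIndepFun ρ P
  indep_reward_rank :
    IndepFun (fun ω (p : Fin K × ℕ) => X p.1 p.2 ω) (fun ω t => ρ t ω) P

/-- The rewards and the tie-breaking rankings of the outcome `ω`. -/
def rewardTable {Ω : Type*} {K : ℕ} (X : Fin K → ℕ → Ω → ℝ) (ω : Ω) : Fin K → ℕ → ℝ :=
  fun a i => X a i ω

/-- The number of pulls of arm `a` after `t` rounds, as a random variable. -/
noncomputable def pulls {Ω : Type*} {K : ℕ} [NeZero K] (U : IndexRule K)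
    (X : Fin K → ℕ → Ω → ℝ) (ρ : ℕ → Ω → Equiv.Perm (Fin K)) (t : ℕ) (a : Fin K) (ω : Ω) : ℕ :=
  counts U (rewardTable X ω) (fun s => ρ s ω) t a

/-- The arm pulled in round `t + 1`, as a random variable. -/
noncomputable def arm {Ω : Type*} {K : ℕ} [NeZero K] (U : IndexRule K)
    (X : Fin K → ℕ → Ω → ℝ) (ρ : ℕ → Ω → Equiv.Perm (Fin K)) (t : ℕ) (ω : Ω) : Fin K :=
  action U (rewardTable X ω) (fun s => ρ s ω) t

/-- The sample mean of arm `a` after `t` rounds, as a random variable. -/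
noncomputable def mean {Ω : Type*} {K : ℕ} [NeZero K] (U : IndexRule K)
    (X : Fin K → ℕ → Ω → ℝ) (ρ : ℕ → Ω → Equiv.Perm (Fin K)) (t : ℕ) (a : Fin K) (ω : Ω) : ℝ :=
  armMean U (rewardTable X ω) (fun s => ρ s ω) t a

/-- The index `U_a(t)` of arm `a` after `t` rounds, as a random variable. -/
noncomputable def index {Ω : Type*} {K : ℕ} [NeZero K] (U : IndexRule K)
    (X : Fin K → ℕ → Ω → ℝ) (ρ : ℕ → Ω → Equiv.Perm (Fin K)) (t : ℕ) (a : Fin K) (ω : Ω) : ℝ :=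
  armIndex U (rewardTable X ω) (fun s => ρ s ω) t a

/-- In the run with horizon `T`, the index of an arm does not increase in a round in which the arm
is not pulled. Indices exist from time `K` on, when every arm has been pulled once. -/
def IndexNonincreasing {Ω : Type*} [MeasurableSpace Ω] {K : ℕ} [NeZero K] (P : Measure Ω)
    (U : IndexRule K) (X : Fin K → ℕ → Ω → ℝ) (ρ : ℕ → Ω → Equiv.Perm (Fin K)) (T : ℕ) : Prop :=
  ∀ᵐ ω ∂P, ∀ t, K ≤ t → t < T → ∀ a, arm U X ρ t ω ≠ a →
    index U X ρ (t + 1) a ω ≤ index U X ρ t a ω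

/-- The event that after `⌊T / (2K)⌋` rounds every arm has been pulled between `T / (4K²)` and
`3T / (4K²)` times. -/
def balancedEvent {Ω : Type*} {K : ℕ} [NeZero K] (U : IndexRule K)
    (X : Fin K → ℕ → Ω → ℝ) (ρ : ℕ → Ω → Equiv.Perm (Fin K)) (T : ℕ) : Set Ω :=
  {ω | ∀ a, (pulls U X ρ (T / (2 * K)) a ω : ℝ) ∈
    Set.Icc ((T : ℝ) / (4 * (K : ℝ) ^ 2)) (3 * (T : ℝ) / (4 * (K : ℝ) ^ 2))}

/-- In the run with horizon `T`, on the balanced event, all indices from time `⌊T / (2K)⌋` on lie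
between two indices with constant bonus factors `β₁` and `β₂`. -/
def IndexSandwiched {Ω : Type*} [MeasurableSpace Ω] {K : ℕ} [NeZero K] (P : Measure Ω)
    (U : IndexRule K) (X : Fin K → ℕ → Ω → ℝ) (ρ : ℕ → Ω → Equiv.Perm (Fin K))
    (β₁ β₂ : ℝ) (T : ℕ) : Prop :=
  ∀ᵐ ω ∂P, ω ∈ balancedEvent U X ρ T → ∀ t, T / (2 * K) ≤ t → t ≤ T → ∀ a,
    mean U X ρ t a ω + β₁ / √(pulls U X ρ t a ω) ≤ index U X ρ t a ω ∧
    index U X ρ t a ω ≤ mean U X ρ t a ω + β₂ / √(pulls U X ρ t a ω)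

/-- Lai–Wei stability of the pull counts of the horizon-`T` runs of the rules `U T`, observed at time
`τ T`: there are non-random `n*_{a,T} → ∞` with `n_{a,τ(T)} / n*_{a,T} → 1` in probability. The case
`τ T = T` is stability at the horizon. -/
def StableAt {Ω : Type*} [MeasurableSpace Ω] {K : ℕ} [NeZero K] (P : Measure Ω)
    (U : ℕ → IndexRule K) (X : Fin K → ℕ → Ω → ℝ) (ρ : ℕ → Ω → Equiv.Perm (Fin K))
    (τ : ℕ → ℕ) : Prop :=
  ∀ a : Fin K, ∃ nstar : ℕ → ℝ,
    TendstoInMeasure P (fun T ω => (pulls (U T) X ρ (τ T) a ω : ℝ) / nstar T) atTop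
      (fun _ => (1 : ℝ)) ∧
    Tendsto nstar atTop atTop

end Bandit

/-!
A lucky start is never corrected. All arms being treated alike, their pull counts at a fixed time
share one law, and stable counts are asymptotic to `τ(T) / K`; so stability at time `⌊T / (2K)⌋`
makes the balanced event asymptotically certain. By the central limit theorem at the smallest sample
size `m`, Kolmogorov's maximal inequality for the sample sizes from `m` to a constant multiple of
`m`, and the independence of the arms, with probability bounded below the centred reward sums of arm
`a` stay above a large multiple of `√m` while those of the other arms stay nonpositive. On the
balanced event the index of `a` then remains above the initial indices of the other arms, which can
only decrease as long as those arms are not pulled. So `a` is pulled in every later round, collects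
at least three quarters of all pulls, and its count cannot be asymptotic to `T / K`.
-/

namespace Bandit

section RandomWalk

variable {Ω : Type*} [MeasurableSpace Ω] {P : Measure Ω} {Y : ℕ → Ω → ℝ}

theorem submartingale_sq [IsFiniteMeasure P] {f : ℕ → Ω → ℝ} {ℱ : Filtration ℕ ‹_›}
    (hf : Martingale f ℱ P) (hL2 : ∀ n, MemLp (f n) 2 P) :
    Submartingale (fun n ω => f n ω ^ 2) ℱ P := by
  have hconvex : ConvexOn ℝ Set.univ fun x : ℝ => x ^ 2 := even_two.convexOn_pow
  refine ⟨fun n => (hf.stronglyMeasurable n).pow 2, fun m n hmn => ?_,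
    fun n => (hL2 n).integrable_sq⟩
  have hjensen := hconvex.map_condExp_le_univ (ℱ.le m)
    (continuous_pow 2).lowerSemicontinuous (hf.integrable n) (hL2 n).integrable_sq
  filter_upwards [hjensen, hf.condExp_ae_eq hmn] with ω hω heq
  exact (congrArg (· ^ 2) heq).symm.trans_le hω

theorem martingale_sum_range_succ (hmeas : ∀ i, StronglyMeasurable (Y i))
    (hint : ∀ i, Integrable (Y i) P) (hindep : iIndepFun Y P) (hzero : ∀ i, P[Y i] = 0) :
    Martingale (fun n ω => ∑ i ∈ Finset.range (n + 1), Y i ω) (Filtration.natural Y hmeas) P := by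
  have := hindep.isProbabilityMeasure
  refine martingale_of_condExp_sub_eq_zero_nat (fun n => ?_)
    (fun n => integrable_finsetSum _ fun i _ => hint i) fun n => ?_
  · refine Finset.stronglyMeasurable_fun_sum _ fun i hi => ?_
    exact (Filtration.stronglyAdapted_natural hmeas i).mono
      ((Filtration.natural Y hmeas).mono (Nat.lt_succ_iff.1 (Finset.mem_range.1 hi)))
  · have hincrement : ((fun ω => ∑ i ∈ Finset.range (n + 1 + 1), Y i ω) -
        fun ω => ∑ i ∈ Finset.range (n + 1), Y i ω) = Y (n + 1) := by
      funext ω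
      simp [Finset.sum_range_succ _ (n + 1)]
    rw [hincrement]
    filter_upwards [hindep.condExp_natural_ae_eq_of_lt hmeas (Nat.lt_succ_self n)] with ω hω
    simpa only [hzero, Pi.zero_apply] using hω

theorem integral_sum_range_sq (hL2 : ∀ i, MemLp (Y i) 2 P) (hindep : iIndepFun Y P)
    (hzero : ∀ i, P[Y i] = 0) (n : ℕ) :
    ∫ ω, (∑ i ∈ Finset.range n, Y i ω) ^ 2 ∂P = ∑ i ∈ Finset.range n, Var[Y i; P] := by
  have := hindep.isProbabilityMeasure
  have hmean : P[fun ω => ∑ i ∈ Finset.range n, Y i ω] = 0 := by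
    rw [integral_finsetSum _ fun i _ => (hL2 i).integrable one_le_two]
    exact Finset.sum_eq_zero fun i _ => hzero i
  have hmem : MemLp (fun ω => ∑ i ∈ Finset.range n, Y i ω) 2 P :=
    memLp_finsetSum _ fun i _ => hL2 i
  rw [← variance_of_integral_eq_zero hmem.aemeasurable hmean,
    ← IndepFun.variance_sum (fun i _ => hL2 i) fun i _ j _ hij => hindep.indepFun hij]
  congr 1
  exact (Finset.sum_fn _ _).symm

theorem kolmogorov_maximal_inequality (hmeas : ∀ i, Measurable (Y i))
    (hL2 : ∀ i, MemLp (Y i) 2 P) (hindep : iIndepFun Y P) (hzero : ∀ i, P[Y i] = 0)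
    (n : ℕ) {d : ℝ} (hd : 0 < d) :
    P.real {ω | ∃ k ≤ n, d ≤ |∑ i ∈ Finset.range k, Y i ω|} ≤
      (∑ i ∈ Finset.range n, Var[Y i; P]) / d ^ 2 := by
  have := hindep.isProbabilityMeasure
  obtain _ | n := n
  · simp [hd.not_ge]
  have hmart := martingale_sum_range_succ (fun i => (hmeas i).stronglyMeasurable)
    (fun i => (hL2 i).integrable one_le_two) hindep hzero
  have hsub := submartingale_sq hmart fun n => memLp_finsetSum _ fun i _ => hL2 i
  set M := {ω | d ^ 2 ≤ (Finset.range (n + 1)).sup' Finset.nonempty_range_add_one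
    fun k => (∑ i ∈ Finset.range (k + 1), Y i ω) ^ 2}
  have hsubset : {ω | ∃ k ≤ n + 1, d ≤ |∑ i ∈ Finset.range k, Y i ω|} ⊆ M := by
    rintro ω ⟨_ | k, hk, hdk⟩
    · simp only [Finset.range_zero, Finset.sum_empty, abs_zero] at hdk
      exact absurd hdk hd.not_ge
    · have hsq : d ^ 2 ≤ (∑ i ∈ Finset.range (k + 1), Y i ω) ^ 2 := by
        simpa only [sq_abs] using pow_le_pow_left₀ hd.le hdk 2
      exact hsq.trans (Finset.le_sup' (fun k => (∑ i ∈ Finset.range (k + 1), Y i ω) ^ 2)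
        (Finset.mem_range.2 hk))
  have hdoob : d ^ 2 * P.real M ≤ ∫ ω in M, (∑ i ∈ Finset.range (n + 1), Y i ω) ^ 2 ∂P := by
    have h := ENNReal.toReal_mono ENNReal.ofReal_ne_top
      (maximal_ineq hsub (fun _ _ => sq_nonneg _) (ε := ⟨d ^ 2, sq_nonneg d⟩) n)
    rwa [ENNReal.toReal_mul, ENNReal.toReal_ofReal (integral_nonneg fun _ => sq_nonneg _)] at h
  rw [le_div_iff₀' (pow_pos hd 2), ← integral_sum_range_sq hL2 hindep hzero]
  calc d ^ 2 * P.real {ω | ∃ k ≤ n + 1, d ≤ |∑ i ∈ Finset.range k, Y i ω|}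
      ≤ d ^ 2 * P.real M := mul_le_mul_of_nonneg_left (measureReal_mono hsubset) (sq_nonneg d)
    _ ≤ ∫ ω in M, (∑ i ∈ Finset.range (n + 1), Y i ω) ^ 2 ∂P := hdoob
    _ ≤ ∫ ω, (∑ i ∈ Finset.range (n + 1), Y i ω) ^ 2 ∂P :=
      setIntegral_le_integral (hsub.integrable n) (ae_of_all _ fun _ => sq_nonneg _)

theorem indepFun_initial_tail (hmeas : ∀ i, Measurable (Y i)) (hindep : iIndepFun Y P) (m : ℕ) :
    IndepFun (fun ω (i : Fin m) => Y i ω) (fun ω i => Y (m + i) ω) P := by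
  have hdisj : Disjoint (Set.Iio m) (Set.Ici m) := Set.Iio_disjoint_Ici le_rfl
  refine indep_of_indep_of_le_left (indep_of_indep_of_le_right
    (indep_iSup_of_disjoint (fun i => (hmeas i).comap_le) hindep hdisj) ?_) ?_
  · simp only [MeasurableSpace.pi, MeasurableSpace.comap_iSup, MeasurableSpace.comap_comp]
    exact iSup_le fun i => le_iSup₂_of_le (m + i) (Set.mem_Ici.2 (Nat.le_add_right m i)) le_rfl
  · simp only [MeasurableSpace.pi, MeasurableSpace.comap_iSup, MeasurableSpace.comap_comp]
    exact iSup_le fun i => le_iSup₂_of_le (i : ℕ) i.2 le_rfl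

theorem mul_measureReal_le_measureReal_forall_le_sum (hmeas : ∀ i, Measurable (Y i))
    (hindep : iIndepFun Y P) (b d : ℝ) (m n : ℕ) :
    P.real {ω | b + d ≤ ∑ i ∈ Finset.range m, Y i ω} *
        (1 - P.real {ω | ∃ k ≤ n, d ≤ |∑ i ∈ Finset.range k, Y (m + i) ω|}) ≤
      P.real {ω | ∀ k ∈ Finset.Icc m (m + n), b ≤ ∑ i ∈ Finset.range k, Y i ω} := by
  have := hindep.isProbabilityMeasure
  set start := {x : Fin m → ℝ | b + d ≤ ∑ i, x i}
  set deviation := {y : ℕ → ℝ | ∃ k ≤ n, d ≤ |∑ i ∈ Finset.range k, y i|}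
  have hstart : MeasurableSet start := measurableSet_le measurable_const (by fun_prop)
  have hdeviation : MeasurableSet deviation := by
    simp only [deviation, Set.ofPred_exists, Set.ofPred_and]
    exact .iUnion fun k => (MeasurableSet.const _).inter
      (measurableSet_le measurable_const (by fun_prop))
  have htail : Measurable fun ω i => Y (m + i) ω := by fun_prop
  have hinter := (indepFun_initial_tail hmeas hindep m).measure_inter_preimage_eq_mul
    start deviationᶜ hstart hdeviation.compl
  calc
    _ = P.real ((fun ω (i : Fin m) => Y i ω) ⁻¹' start) *
        P.real ((fun ω i => Y (m + i) ω) ⁻¹' deviationᶜ) := by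
      rw [Set.preimage_compl, probReal_compl_eq_one_sub (htail hdeviation)]
      simp only [start, Set.preimage_ofPred_eq, Finset.sum_range, deviation]
    _ = P.real ((fun ω (i : Fin m) => Y i ω) ⁻¹' start ∩
        (fun ω i => Y (m + i) ω) ⁻¹' deviationᶜ) := by
      simp only [Measure.real, hinter, ENNReal.toReal_mul]
    _ ≤ _ := measureReal_mono ?_
  rintro ω ⟨hω, hsmall⟩ k hk
  obtain ⟨j, rfl⟩ := Nat.exists_eq_add_of_le (Finset.mem_Icc.1 hk).1
  have hj : |∑ i ∈ Finset.range j, Y (m + i) ω| < d :=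
    not_le.1 fun h => hsmall ⟨j, by simpa using hk, h⟩
  have hb : b + d ≤ ∑ i ∈ Finset.range m, Y i ω := hω.trans_eq (Finset.sum_range _).symm
  rw [Finset.sum_range_add]
  linarith [(abs_lt.1 hj).1]

theorem exists_pos_le_measureReal_le_sum (hindep : iIndepFun Y P)
    (hident : ∀ i, IdentDistrib (Y i) (Y 0) P P) (hzero : P[Y 0] = 0) (hvar : 0 < Var[Y 0; P])
    (c : ℝ) :
    ∃ p : ℝ, 0 < p ∧ ∀ᶠ n : ℕ in atTop, p ≤ P.real {ω | c * √n ≤ ∑ i ∈ Finset.range n, Y i ω} := by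
  have := hindep.isProbabilityMeasure
  set γ := gaussianReal 0 Var[Y 0; P].toNNReal
  have hL2 : MemLp (Y 0) 2 P := memLp_two_of_variance_ne_zero
    (hident 0).aemeasurable_fst.aestronglyMeasurable hvar.ne'
  have hclt := tendstoInDistribution_inv_sqrt_mul_sum_sub HasLaw.id hL2 hindep hident
  simp only [hzero, mul_zero, sub_zero] at hclt
  have hliminf := ProbabilityMeasure.le_liminf_measure_open_of_tendsto hclt.tendsto
    (isOpen_Ioi (a := c))
  simp only [ProbabilityMeasure.coe_mk, Measure.map_id] at hliminf
  have hpos : 0 < γ (Set.Ioi c) := by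
    have := (gaussianReal_absolutelyContinuous' 0 (Real.toNNReal_pos.2 hvar).ne').isOpenPosMeasure
    exact isOpen_Ioi.measure_pos γ Set.nonempty_Ioi
  obtain ⟨p, hp0, hp⟩ := exists_between (hpos.trans_le hliminf)
  have hptop : p ≠ ∞ := ne_top_of_lt hp
  refine ⟨p.toReal, ENNReal.toReal_pos hp0.ne' hptop, ?_⟩
  filter_upwards [eventually_lt_of_lt_liminf hp, eventually_gt_atTop 0] with n hn hn0
  have hsqrt : 0 < √(n : ℝ) := Real.sqrt_pos.2 (Nat.cast_pos.2 hn0)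
  refine ENNReal.toReal_mono (measure_ne_top _ _) (hn.le.trans ?_)
  rw [Measure.map_apply_of_aemeasurable (hclt.forall_aemeasurable n) measurableSet_Ioi]
  refine measure_mono fun ω hω => ?_
  simp only [Set.mem_preimage, Set.mem_Ioi, inv_mul_eq_div] at hω
  exact ((lt_div_iff₀ hsqrt).1 hω).le

theorem exists_pos_le_measureReal_forall_le_sum (hmeas : ∀ i, Measurable (Y i))
    (hindep : iIndepFun Y P) (hident : ∀ i, IdentDistrib (Y i) (Y 0) P P) (hzero : P[Y 0] = 0)
    (hvar : 0 < Var[Y 0; P]) (c : ℝ) (A : ℕ) :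
    ∃ p : ℝ, 0 < p ∧ ∀ᶠ m : ℕ in atTop,
      p ≤ P.real {ω | ∀ n ∈ Finset.Icc m (A * m), c * √m ≤ ∑ i ∈ Finset.range n, Y i ω} := by
  have := hindep.isProbabilityMeasure
  set v := Var[Y 0; P]
  have hL2 : MemLp (Y 0) 2 P :=
    memLp_two_of_variance_ne_zero (hmeas 0).aestronglyMeasurable hvar.ne'
  -- For this `d`, Kolmogorov's bound `A * m * v / (d√m)²` on the deviations is at most `1 / 2`.
  set d := √(2 * (A + 1) * v)
  have hd : d ^ 2 = 2 * (A + 1) * v := Real.sq_sqrt (by positivity)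
  have hd0 : 0 < d := Real.sqrt_pos.2 (by positivity)
  obtain ⟨p, hp, hev⟩ := exists_pos_le_measureReal_le_sum hindep hident hzero hvar (c + d)
  refine ⟨p * (1 / 2), by positivity, ?_⟩
  filter_upwards [hev, eventually_gt_atTop 0] with m hm hm0
  have hmpos : (0 : ℝ) < m := Nat.cast_pos.2 hm0
  have hdeviation :
      P.real {ω | ∃ k ≤ A * m, d * √m ≤ |∑ i ∈ Finset.range k, Y (m + i) ω|} ≤ 1 / 2 := by
    refine (kolmogorov_maximal_inequality (fun i => hmeas (m + i))
      (fun i => (hident _).memLp_iff.2 hL2) (hindep.precomp (add_right_injective m))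
      (fun i => (hident _).integral_eq.trans hzero) (A * m)
      (mul_pos hd0 (Real.sqrt_pos.2 hmpos))).trans ?_
    simp only [(hident _).variance_eq, Finset.sum_const, Finset.card_range, nsmul_eq_mul, mul_pow,
      hd, Real.sq_sqrt hmpos.le]
    rw [div_le_iff₀ (by positivity)]
    push_cast
    nlinarith [mul_pos hvar hmpos]
  calc p * (1 / 2)
      ≤ P.real {ω | c * √m + d * √m ≤ ∑ i ∈ Finset.range m, Y i ω} *
        (1 - P.real {ω | ∃ k ≤ A * m, d * √m ≤ |∑ i ∈ Finset.range k, Y (m + i) ω|}) := by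
        rw [← add_mul]
        exact mul_le_mul hm (by linarith) (by norm_num) measureReal_nonneg
    _ ≤ P.real {ω | ∀ n ∈ Finset.Icc m (m + A * m), c * √m ≤ ∑ i ∈ Finset.range n, Y i ω} :=
      mul_measureReal_le_measureReal_forall_le_sum hmeas hindep _ _ m (A * m)
    _ ≤ _ := measureReal_mono fun ω hω n hn =>
      hω n (Finset.Icc_subset_Icc_right (Nat.le_add_left _ _) hn)

end RandomWalk

section Dynamics

variable {K : ℕ} [NeZero K]

theorem pick_eq_iff {u : Fin K → ℝ} {r : Equiv.Perm (Fin K)} {a : Fin K} :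
    pick u r = a ↔ (∀ b, u b ≤ u a) ∧ ∀ b, (∀ c, u c ≤ u b) → r a ≤ r b := by
  have hmem : ∀ b, b ∈ argmaxSet u ↔ ∀ c, u c ≤ u b := fun b => by
    rw [argmaxSet, Finset.mem_filter_univ]
  have hmin : ∀ b, (∀ c, u c ≤ u b) → r (pick u r) ≤ r b := fun b hb => by
    rw [pick, Equiv.apply_symm_apply]
    exact Finset.min'_le _ _ (Finset.mem_map_of_mem _ ((hmem b).2 hb))
  have hmax : ∀ c, u c ≤ u (pick u r) := by
    obtain ⟨b, hb, hrb⟩ := Finset.mem_map.1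
      (Finset.min'_mem _ ((argmaxSet_nonempty u).map (f := r.toEmbedding)))
    have hpick : pick u r = b := by
      rw [pick, ← hrb, Equiv.coe_toEmbedding, Equiv.symm_apply_apply]
    exact hpick ▸ (hmem b).1 hb
  refine ⟨by rintro rfl; exact ⟨hmax, hmin⟩, fun ⟨hamax, hamin⟩ => ?_⟩
  exact r.injective (le_antisymm (hmin a hamax) (hamin _ hmax))

theorem pick_eq_of_forall_lt {u : Fin K → ℝ} {a : Fin K} (h : ∀ b, b ≠ a → u b < u a)
    (r : Equiv.Perm (Fin K)) : pick u r = a := by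
  refine pick_eq_iff.2 ⟨fun b => ?_, fun b hb => ?_⟩
  · obtain rfl | hba := eq_or_ne b a
    exacts [le_rfl, (h b hba).le]
  · obtain rfl | hba := eq_or_ne b a
    exacts [le_rfl, absurd (hb a) (h b hba).not_ge]

theorem apply_pick_comp_perm (u : Fin K → ℝ) (r σ : Equiv.Perm (Fin K)) :
    σ (pick (u ∘ σ) (r * σ)) = pick u r := by
  obtain ⟨hmax, hmin⟩ := pick_eq_iff.1 (rfl : pick (u ∘ σ) (r * σ) = _)
  refine (pick_eq_iff.2 ⟨fun b => by simpa using hmax (σ.symm b), fun b hb => ?_⟩).symm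
  simpa using hmin (σ.symm b) fun c => by simpa using hb (σ c)

theorem measurable_pick : Measurable fun p : (Fin K → ℝ) × Equiv.Perm (Fin K) => pick p.1 p.2 := by
  refine measurable_from_prod_countable_left fun r => measurable_to_countable' fun a => ?_
  have hpreimage : (fun u : Fin K → ℝ => pick u r) ⁻¹' {a} =
      (⋂ b, {u | u b ≤ u a}) ∩ ⋂ b, {u | (∀ c, u c ≤ u b) → r a ≤ r b} := by
    ext u
    simp [pick_eq_iff]
  rw [hpreimage]
  refine (MeasurableSet.iInter fun b => measurableSet_le (by fun_prop) (by fun_prop)).inter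
    (MeasurableSet.iInter fun b => ?_)
  have hmax : MeasurableSet {u : Fin K → ℝ | ∀ c, u c ≤ u b} := by
    rw [Set.ofPred_forall]
    exact .iInter fun c => measurableSet_le (by fun_prop) (by fun_prop)
  exact hmax.imp (.const _)

theorem counts_succ (U : IndexRule K) (x : Fin K → ℕ → ℝ) (r : ℕ → Equiv.Perm (Fin K)) (t : ℕ)
    (a : Fin K) :
    counts U x r (t + 1) a = counts U x r t a + if action U x r t = a then 1 else 0 := rfl

theorem counts_of_le (U : IndexRule K) (x : Fin K → ℕ → ℝ) (r : ℕ → Equiv.Perm (Fin K)) {t : ℕ}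
    (ht : t ≤ K) (a : Fin K) : counts U x r t a = if (a : ℕ) < t then 1 else 0 := by
  induction t with
  | zero => rfl
  | succ t ih =>
    have haction : action U x r t = ⟨t, ht⟩ := dif_pos ht
    rw [counts_succ, ih (by omega), haction]
    simp only [Fin.ext_iff]
    split_ifs <;> omega

theorem counts_comp_perm {U : IndexRule K} (hU : IsSymmetricRule U) (x : Fin K → ℕ → ℝ)
    (r : ℕ → Equiv.Perm (Fin K)) (σ : Equiv.Perm (Fin K)) {t : ℕ} (ht : K ≤ t) :
    counts U (x ∘ σ) (fun s => r s * σ) t = counts U x r t ∘ σ := by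
  induction t, ht using Nat.le_induction with
  | base => funext a; simp [counts_of_le]
  | succ t ht ih =>
    have haction : σ (action U (x ∘ σ) (fun s => r s * σ) t) = action U x r t := by
      simp only [action, nextArm, ht.not_gt, dif_neg, not_false_eq_true, ih]
      rw [← apply_pick_comp_perm _ (r t) σ]
      congr 3
      funext a
      exact hU σ (fun a => sampleMean (x a) (counts U x r t a)) (counts U x r t) a
    funext a
    rw [Function.comp_apply, counts_succ, counts_succ, ih, ← haction]
    simp only [Function.comp_apply, σ.injective.eq_iff]

theorem measurable_counts {U : IndexRule K} (hU : IsMeasurableRule U) (t : ℕ) :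
    Measurable fun p : (Fin K → ℕ → ℝ) × (ℕ → Equiv.Perm (Fin K)) => counts U p.1 p.2 t := by
  induction t with
  | zero => exact measurable_const
  | succ t ih =>
    have hnext : Measurable fun q : ((Fin K → ℕ → ℝ) × (ℕ → Equiv.Perm (Fin K))) ×
        (Fin K → ℕ) => nextArm U q.1.1 (q.1.2 t) t q.2 := by
      refine measurable_from_prod_countable_left fun n => ?_
      by_cases ht : t < K
      · simp only [nextArm, ht, dif_pos, measurable_const]
      · simp only [nextArm, ht, dif_neg, not_false_eq_true]
        refine measurable_pick.comp (Measurable.prodMk ?_ (by fun_prop))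
        refine measurable_pi_lambda _ fun a => (hU n a).comp (measurable_pi_lambda _ fun b => ?_)
        unfold sampleMean
        fun_prop
    have haction : Measurable fun p : (Fin K → ℕ → ℝ) × (ℕ → Equiv.Perm (Fin K)) =>
        action U p.1 p.2 t := hnext.comp (measurable_id.prodMk ih)
    refine measurable_pi_lambda _ fun a => ?_
    simp only [counts_succ]
    exact ((measurable_pi_apply a).comp ih).add (Measurable.ite
      (haction (measurableSet_singleton a)) measurable_const measurable_const)

variable {U : IndexRule K} {x : Fin K → ℕ → ℝ} {r : ℕ → Equiv.Perm (Fin K)}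

theorem sum_counts (t : ℕ) : ∑ a, counts U x r t a = t := by
  induction t with
  | zero => simp [counts]
  | succ t ih => simp [counts_succ, Finset.sum_add_distrib, ih]

theorem counts_le (t : ℕ) (a : Fin K) : counts U x r t a ≤ t :=
  (Finset.single_le_sum_of_canonicallyOrdered (Finset.mem_univ a)).trans (sum_counts t).le

theorem counts_mono (a : Fin K) : Monotone fun t => counts U x r t a :=
  monotone_nat_of_le_succ fun _ => Nat.le_add_right _ _

theorem sub_le_counts {s t : ℕ} {a : Fin K} (hst : s ≤ t)
    (hpulled : ∀ q, s ≤ q → q < t → action U x r q = a) : t - s ≤ counts U x r t a := by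
  induction t, hst using Nat.le_induction with
  | base => simp
  | succ t hst ih =>
    have hlast := hpulled t hst t.lt_succ_self
    have hearlier := ih fun q hsq hqt => hpulled q hsq (hqt.trans t.lt_succ_self)
    rw [counts_succ, if_pos hlast]
    omega

theorem action_eq_of_forall_lt {s T : ℕ} (hs : K ≤ s) {a : Fin K} {z : ℝ}
    (hmono : ∀ t, s ≤ t → t < T → ∀ b, action U x r t ≠ b →
      armIndex U x r (t + 1) b ≤ armIndex U x r t b)
    (hlow : ∀ t, s ≤ t → t < T → z < armIndex U x r t a)
    (hup : ∀ b, b ≠ a → armIndex U x r s b ≤ z) {t : ℕ} (hst : s ≤ t) (htT : t < T) :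
    action U x r t = a := by
  have hpull : ∀ t, s ≤ t → t < T → (∀ b, b ≠ a → armIndex U x r t b ≤ z) → action U x r t = a := by
    intro t hst htT hle
    rw [action, nextArm, dif_neg (hs.trans hst).not_gt]
    exact pick_eq_of_forall_lt (fun b hb => (hle b hb).trans_lt (hlow t hst htT)) _
  refine hpull t hst htT ?_
  induction t, hst using Nat.le_induction with
  | base => exact hup
  | succ t hst ih =>
    have htT' : t < T := t.lt_succ_self.trans htT
    intro b hb
    have hne : action U x r t ≠ b := hpull t hst htT' (ih htT') ▸ hb.symm
    exact (hmono t hst htT' b hne).trans (ih htT' b hb)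

end Dynamics

section Domination

theorem sampleMean_eq_add {x : ℕ → ℝ} {n : ℕ} (hn : n ≠ 0) (μ : ℝ) :
    sampleMean x n = μ + (∑ i ∈ Finset.range n, (x i - μ)) / n := by
  have hn' : (n : ℝ) ≠ 0 := Nat.cast_ne_zero.2 hn
  rw [sampleMean, Finset.sum_sub_distrib, Finset.sum_const, Finset.card_range, nsmul_eq_mul]
  field_simp
  ring

theorem sampleMean_le_of_sum_sub_nonpos {x : ℕ → ℝ} {n : ℕ} {μ : ℝ} (hn : n ≠ 0)
    (h : ∑ i ∈ Finset.range n, (x i - μ) ≤ 0) : sampleMean x n ≤ μ := by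
  rw [sampleMean_eq_add hn μ]
  linarith [div_nonpos_of_nonpos_of_nonneg h n.cast_nonneg]

theorem add_div_sqrt_le_sampleMean {x : ℕ → ℝ} {m n A : ℕ} {μ c : ℝ} (hc : 0 ≤ c) (hm : 0 < m)
    (hn : n ∈ Finset.Icc m (A * m)) (h : A * c * √m ≤ ∑ i ∈ Finset.range n, (x i - μ)) :
    μ + c / √m ≤ sampleMean x n := by
  obtain ⟨hmn, hnA⟩ := Finset.mem_Icc.1 hn
  have hn0 : 0 < n := hm.trans_le hmn
  have : 0 < √(m : ℝ) := Real.sqrt_pos.2 (Nat.cast_pos.2 hm)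
  have hnA' : (n : ℝ) ≤ A * m := by exact_mod_cast hnA
  rw [sampleMean_eq_add hn0.ne' μ]
  refine add_le_add le_rfl ((le_div_iff₀ (Nat.cast_pos.2 hn0)).2 ?_)
  calc c / √m * n ≤ c / √m * (A * m) := by gcongr
    _ = A * c * (m / √m) := by ring
    _ = A * c * √m := by rw [Real.div_sqrt]
    _ ≤ _ := h

theorem abs_div_sqrt_le {m n : ℕ} (hm : 0 < m) (hmn : m ≤ n) (β : ℝ) :
    |β / √(n : ℝ)| ≤ |β| / √(m : ℝ) := by
  have : 0 < √(m : ℝ) := Real.sqrt_pos.2 (Nat.cast_pos.2 hm)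
  rw [abs_div, abs_of_nonneg (Real.sqrt_nonneg _)]
  gcongr

variable {K : ℕ}

/-- Arm `a` dominates the reward table `x` at sample sizes `m, …, M`: its reward sums exceed those
of constant rewards `μ` by at least `d`, and the reward sums of all other arms do not exceed those
of constant rewards `μ`. -/
def IsDominant (x : Fin K → ℕ → ℝ) (μ d : ℝ) (m M : ℕ) (a : Fin K) : Prop :=
  ∀ n ∈ Finset.Icc m M, d ≤ ∑ i ∈ Finset.range n, (x a i - μ) ∧
    ∀ b, b ≠ a → ∑ i ∈ Finset.range n, (x b i - μ) ≤ 0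

variable [NeZero K] {U : IndexRule K} {x : Fin K → ℕ → ℝ} {r : ℕ → Equiv.Perm (Fin K)}

theorem IsDominant.action_eq {s T m A : ℕ} {a : Fin K} {β₁ β₂ μ : ℝ}
    (hdom : IsDominant x μ (A * (|β₁| + |β₂| + 1) * √m) m (A * m) a) (hs : K ≤ s) (hm : 0 < m)
    (hA : T ≤ A * m) (hcount : ∀ b, m ≤ counts U x r s b)
    (hmono : ∀ t, s ≤ t → t < T → ∀ b, action U x r t ≠ b →
      armIndex U x r (t + 1) b ≤ armIndex U x r t b)
    (hsand : ∀ t, s ≤ t → t ≤ T → ∀ b,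
      armMean U x r t b + β₁ / √(counts U x r t b) ≤ armIndex U x r t b ∧
      armIndex U x r t b ≤ armMean U x r t b + β₂ / √(counts U x r t b))
    {t : ℕ} (hst : s ≤ t) (htT : t < T) : action U x r t = a := by
  have hmem : ∀ t, s ≤ t → t ≤ T → ∀ b, counts U x r t b ∈ Finset.Icc m (A * m) :=
    fun t hst htT b => Finset.mem_Icc.2 ⟨(hcount b).trans (counts_mono b hst),
      (counts_le t b).trans (htT.trans hA)⟩
  have hbonus : ∀ t, s ≤ t → t ≤ T → ∀ b β, |β / √(counts U x r t b)| ≤ |β| / √m :=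
    fun t hst htT b => abs_div_sqrt_le hm (Finset.mem_Icc.1 (hmem t hst htT b)).1
  refine action_eq_of_forall_lt hs (z := μ + |β₂| / √m) hmono (fun t hst htT => ?_)
    (fun b hb => ?_) hst htT
  · have hcount_mem := hmem t hst htT.le a
    have hmean : μ + (|β₁| + |β₂| + 1) / √m ≤ armMean U x r t a :=
      add_div_sqrt_le_sampleMean (by positivity) hm hcount_mem (hdom _ hcount_mem).1
    have hpos : 0 < 1 / √(m : ℝ) := by positivity
    rw [add_div, add_div] at hmean
    linarith [(hsand t hst htT.le a).1, neg_le_of_abs_le (hbonus t hst htT.le a β₁)]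
  · have hsT : s ≤ T := hst.trans htT.le
    have hcount_mem := hmem s le_rfl hsT b
    have hmean : armMean U x r s b ≤ μ :=
      sampleMean_le_of_sum_sub_nonpos (hm.trans_le (hcount b)).ne' ((hdom _ hcount_mem).2 b hb)
    linarith [(hsand s le_rfl hsT b).2, le_of_abs_le (hbonus s le_rfl hsT b β₂)]

end Domination

section Environment

theorem map_mul_right_uniformOfFintype {G : Type*} [Group G] [Fintype G] [MeasurableSpace G]
    [MeasurableSingletonClass G] (g : G) :
    (PMF.uniformOfFintype G).toMeasure.map (· * g) = (PMF.uniformOfFintype G).toMeasure := by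
  refine Measure.ext_of_singleton fun h => ?_
  have hpreimage : (· * g) ⁻¹' {h} = {h * g⁻¹} := by
    ext k
    simp [eq_mul_inv_iff_mul_eq]
  rw [Measure.map_apply .of_discrete (measurableSet_singleton h), hpreimage,
    PMF.toMeasure_apply_singleton _ _ (measurableSet_singleton _),
    PMF.toMeasure_apply_singleton _ _ (measurableSet_singleton _),
    PMF.uniformOfFintype_apply, PMF.uniformOfFintype_apply]

theorem iIndepFun_curry {ι κ Ω E : Type*} [Countable ι] [Countable κ] [MeasurableSpace Ω]
    [MeasurableSpace E] {P : Measure Ω} {X : ι → κ → Ω → E} (hX : ∀ i j, Measurable (X i j))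
    (hindep : iIndepFun (fun (p : ι × κ) ω => X p.1 p.2 ω) P) :
    iIndepFun (fun i ω j => X i j ω) P := by
  have := hindep.isProbabilityMeasure
  have hprob : ∀ i j, IsProbabilityMeasure (P.map (X i j)) := fun i j =>
    Measure.isProbabilityMeasure_map (hX i j).aemeasurable
  have hrow : ∀ i, P.map (fun ω j => X i j ω) = Measure.infinitePi fun j => P.map (X i j) :=
    fun i => (hindep.precomp (Prod.mk_right_injective i)).map_fun_eq_infinitePi_map (hX i)
  rw [iIndepFun_iff_map_fun_eq_infinitePi_map fun i => measurable_pi_lambda _ (hX i)]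
  simp only [hrow]
  rw [← Measure.infinitePi_map_curry fun i j => P.map (X i j),
    ← hindep.map_fun_eq_infinitePi_map fun p : ι × κ => hX p.1 p.2,
    Measure.map_map (by fun_prop) (by fun_prop)]
  rfl

variable {Ω : Type*} [MeasurableSpace Ω] {P : Measure Ω} {K : ℕ} {ν : Measure ℝ}
  {X : Fin K → ℕ → Ω → ℝ} {ρ : ℕ → Ω → Equiv.Perm (Fin K)}

namespace IsEnvironment

theorem comp_perm (henv : IsEnvironment P ν X ρ) (σ : Equiv.Perm (Fin K)) :
    IsEnvironment P ν (X ∘ σ) fun t ω => ρ t ω * σ where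
  measurable_reward a := henv.measurable_reward (σ a)
  law_reward a := henv.law_reward (σ a)
  indep_reward := henv.indep_reward.precomp (g := Prod.map σ id)
    (σ.injective.prodMap Function.injective_id)
  measurable_rank t := (Measurable.of_discrete (f := (· * σ))).comp (henv.measurable_rank t)
  law_rank t := by
    rw [← map_mul_right_uniformOfFintype σ, ← henv.law_rank t,
      Measure.map_map .of_discrete (henv.measurable_rank t)]
    rfl
  indep_rank := henv.indep_rank.comp (fun _ r => r * σ) fun _ => .of_discrete
  indep_reward_rank := henv.indep_reward_rank.comp
    (φ := fun (x : Fin K × ℕ → ℝ) (p : Fin K × ℕ) => x (σ p.1, p.2))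
    (ψ := fun (r : ℕ → Equiv.Perm (Fin K)) t => r t * σ) (by fun_prop)
    (measurable_pi_lambda _ fun t =>
      (Measurable.of_discrete (f := (· * σ))).comp (measurable_pi_apply t))

theorem identDistrib_rewardTable_rank (henv : IsEnvironment P ν X ρ) {Ω' : Type*}
    [MeasurableSpace Ω'] {P' : Measure Ω'} {X' : Fin K → ℕ → Ω' → ℝ}
    {ρ' : ℕ → Ω' → Equiv.Perm (Fin K)} (henv' : IsEnvironment P' ν X' ρ') :
    IdentDistrib (fun ω => (rewardTable X ω, fun t => ρ t ω))
      (fun ω => (rewardTable X' ω, fun t => ρ' t ω)) P P' := by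
  have := henv.indep_rank.isProbabilityMeasure
  have hreward : ∀ p : Fin K × ℕ, IdentDistrib (X p.1 p.2) (X' p.1 p.2) P P' := fun p =>
    ⟨(henv.measurable_reward _ _).aemeasurable, (henv'.measurable_reward _ _).aemeasurable,
      (henv.law_reward _ _).trans (henv'.law_reward _ _).symm⟩
  have hrank : ∀ t, IdentDistrib (ρ t) (ρ' t) P P' := fun t =>
    ⟨(henv.measurable_rank t).aemeasurable, (henv'.measurable_rank t).aemeasurable,
      (henv.law_rank t).trans (henv'.law_rank t).symm⟩
  have hpair := (IdentDistrib.pi hreward henv.indep_reward henv'.indep_reward).prodMk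
    (IdentDistrib.pi hrank henv.indep_rank henv'.indep_rank)
    henv.indep_reward_rank henv'.indep_reward_rank
  exact hpair.comp (u := fun q => (fun a i => q.1 (a, i), q.2)) (by fun_prop)

theorem identDistrib_pulls [NeZero K] (henv : IsEnvironment P ν X ρ) {U : IndexRule K}
    (hmeas : IsMeasurableRule U) (hsymm : IsSymmetricRule U) {t : ℕ} (ht : K ≤ t) (a b : Fin K) :
    IdentDistrib (pulls U X ρ t a) (pulls U X ρ t b) P P := by
  set σ := Equiv.swap b a
  have hpulls : pulls U X ρ t a = pulls U (X ∘ σ) (fun t ω => ρ t ω * σ) t b := by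
    funext ω
    refine Eq.trans ?_
      (congrFun (counts_comp_perm hsymm (rewardTable X ω) (fun t => ρ t ω) σ ht) b).symm
    simp [σ, pulls]
  rw [hpulls]
  exact ((henv.comp_perm σ).identDistrib_rewardTable_rank henv).comp
    ((measurable_pi_apply b).comp (measurable_counts hmeas t))

theorem measureReal_forall_rewardTable_mem (henv : IsEnvironment P ν X ρ)
    {S : Fin K → Set (ℕ → ℝ)} (hS : ∀ a, MeasurableSet (S a)) :
    P.real {ω | ∀ a, rewardTable X ω a ∈ S a} = ∏ a, P.real {ω | rewardTable X ω a ∈ S a} := by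
  have hrows : iIndepFun (fun a ω => rewardTable X ω a) P :=
    iIndepFun_curry henv.measurable_reward henv.indep_reward
  have hinter : P (⋂ a, {ω | rewardTable X ω a ∈ S a}) =
      ∏ a, P {ω | rewardTable X ω a ∈ S a} :=
    hrows.meas_iInter fun a => ⟨S a, hS a, rfl⟩
  rw [Set.ofPred_forall, Measure.real, hinter, ENNReal.toReal_prod]
  rfl

theorem exists_pos_le_measureReal_forall_le_sum (henv : IsEnvironment P ν X ρ)
    (hvar : 0 < Var[id; ν]) {s : ℝ} (hs : s ≠ 0) (c : ℝ) (A : ℕ) (a : Fin K) :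
    ∃ p : ℝ, 0 < p ∧ ∀ᶠ m : ℕ in atTop, p ≤ P.real {ω | ∀ n ∈ Finset.Icc m (A * m),
      c * √m ≤ ∑ i ∈ Finset.range n, s * (X a i ω - ∫ y, y ∂ν)} := by
  have := henv.indep_rank.isProbabilityMeasure
  have hX := henv.measurable_reward
  set μ := ∫ y, y ∂ν
  have hg : Measurable fun y => s * (y - μ) := by fun_prop
  have hident : ∀ i, IdentDistrib (X a i) id P ν := fun i =>
    ⟨(hX a i).aemeasurable, aemeasurable_id, by rw [henv.law_reward, Measure.map_id]⟩
  have hvarX : 0 < Var[X a 0; P] := hvar.trans_eq (hident 0).variance_eq.symm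
  have hint : Integrable (X a 0) P := (memLp_two_of_variance_ne_zero
    (hX a 0).aestronglyMeasurable hvarX.ne').integrable one_le_two
  refine Bandit.exists_pos_le_measureReal_forall_le_sum (Y := fun i ω => s * (X a i ω - μ))
    (fun i => hg.comp (hX a i))
    ((henv.indep_reward.precomp (Prod.mk_right_injective a)).comp _ fun _ => hg)
    (fun i => ((hident i).trans (hident 0).symm).comp hg) ?_ ?_ c A
  · have hmean : P[X a 0] = μ := (hident 0).integral_eq
    rw [integral_const_mul, integral_sub hint (integrable_const μ), hmean]
    simp
  · rw [variance_const_mul, variance_sub_const (hX a 0).aestronglyMeasurable]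
    positivity

theorem exists_pos_le_measureReal_isDominant (henv : IsEnvironment P ν X ρ)
    (hvar : 0 < Var[id; ν]) (c : ℝ) (A : ℕ) (a : Fin K) :
    ∃ p : ℝ, 0 < p ∧ ∀ᶠ m : ℕ in atTop,
      p ≤ P.real {ω | IsDominant (rewardTable X ω) (∫ y, y ∂ν) (c * √m) m (A * m) a} := by
  have := henv.indep_rank.isProbabilityMeasure
  set μ := ∫ y, y ∂ν
  set s : Fin K → ℝ := fun b => if b = a then 1 else -1
  set level : Fin K → ℝ := fun b => if b = a then c else 0
  have hs : ∀ b, s b ≠ 0 := fun b => by simp only [s]; split_ifs <;> norm_num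
  choose p hp hev using fun b =>
    henv.exists_pos_le_measureReal_forall_le_sum hvar (hs b) (level b) A b
  refine ⟨∏ b, p b, Finset.prod_pos fun b _ => hp b, ?_⟩
  filter_upwards [eventually_all.2 hev] with m hm
  set S : Fin K → Set (ℕ → ℝ) := fun b => {x | ∀ n ∈ Finset.Icc m (A * m),
    level b * √m ≤ ∑ i ∈ Finset.range n, s b * (x i - μ)}
  have hS : ∀ b, MeasurableSet (S b) := fun b => by
    simp only [S, Set.ofPred_forall]
    exact .iInter fun n => .iInter fun _ => measurableSet_le measurable_const (by fun_prop)
  calc ∏ b, p b ≤ ∏ b, P.real {ω | rewardTable X ω b ∈ S b} :=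
        Finset.prod_le_prod (fun b _ => (hp b).le) fun b _ => hm b
    _ = P.real {ω | ∀ b, rewardTable X ω b ∈ S b} :=
        (henv.measureReal_forall_rewardTable_mem hS).symm
    _ ≤ P.real {ω | IsDominant (rewardTable X ω) μ (c * √m) m (A * m) a} :=
        measureReal_mono fun ω hω n hn => ⟨?_, fun b hb => ?_⟩
  · simpa [s, level] using hω a n hn
  · simpa [s, level, hb] using hω b n hn

end IsEnvironment

end Environment

section Stability

theorem dist_div_average_one_lt {ι : Type*} [Fintype ι] {u : ι → ℝ} {ε : ℝ} (hε : 0 < ε)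
    (hu : ∀ b, dist (u b) 1 < ε / (2 + ε)) (a : ι) :
    dist (u a / ((∑ b, u b) / Fintype.card ι)) 1 < ε := by
  set δ := ε / (2 + ε)
  have hδ : ε * (1 - δ) = 2 * δ := by simp only [δ]; field_simp; ring
  have hδ1 : δ < 1 := (div_lt_one (by positivity)).2 (by linarith)
  have hcard : (0 : ℝ) < Fintype.card ι := Nat.cast_pos.2 (Fintype.card_pos_iff.2 ⟨a⟩)
  have hbounds : ∀ b, 1 - δ < u b ∧ u b < 1 + δ := fun b => by
    have h := abs_sub_lt_iff.1 (hu b)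
    constructor <;> linarith
  have hsum_low : (1 - δ) * Fintype.card ι < ∑ b, u b := by
    have h := Finset.sum_lt_sum_of_nonempty ⟨a, Finset.mem_univ a⟩ fun b _ => (hbounds b).1
    rwa [Finset.sum_const, nsmul_eq_mul, mul_comm] at h
  have hsum_up : ∑ b, u b < (1 + δ) * Fintype.card ι := by
    have h := Finset.sum_lt_sum_of_nonempty ⟨a, Finset.mem_univ a⟩ fun b _ => (hbounds b).2
    rwa [Finset.sum_const, nsmul_eq_mul, mul_comm] at h
  have hlow : 1 - δ < (∑ b, u b) / Fintype.card ι := (lt_div_iff₀ hcard).2 hsum_low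
  have hup : (∑ b, u b) / Fintype.card ι < 1 + δ := (div_lt_iff₀ hcard).2 hsum_up
  set average := (∑ b, u b) / Fintype.card ι
  have haverage : 0 < average := by linarith
  have hclose : |u a - average| < ε * average := by
    have hscale := mul_lt_mul_of_pos_left hlow hε
    refine abs_sub_lt_iff.2 ⟨?_, ?_⟩ <;> linarith [(hbounds a).1, (hbounds a).2]
  rwa [Real.dist_eq, div_sub_one haverage.ne', abs_div, abs_of_pos haverage, div_lt_iff₀ haverage]

variable {Ω : Type*} {K : ℕ} [NeZero K] {X : Fin K → ℕ → Ω → ℝ} {ρ : ℕ → Ω → Equiv.Perm (Fin K)}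

theorem mem_balancedEvent_of_dist_lt {U : IndexRule K} {T : ℕ} (hT : 8 * K ≤ T) {ω : Ω}
    (h : ∀ a, dist (pulls U X ρ (T / (2 * K)) a ω / (((T / (2 * K) : ℕ) : ℝ) / K)) 1 < 1 / 3) :
    ω ∈ balancedEvent U X ρ T := by
  have hKpos := Nat.pos_of_neZero K
  have hK : (0 : ℝ) < K := Nat.cast_pos.2 hKpos
  set τ := T / (2 * K)
  have hT' : (8 : ℝ) * K ≤ T := by exact_mod_cast hT
  have hle : (τ : ℝ) * (2 * K) ≤ T := by exact_mod_cast Nat.div_mul_le_self T (2 * K)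
  have hlt : (T : ℝ) < 2 * K * (τ + 1) := by
    exact_mod_cast Nat.lt_mul_div_succ T (by positivity : 0 < 2 * K)
  have hτ : (0 : ℝ) < τ := by nlinarith
  intro a
  have ha := abs_sub_lt_iff.1 (h a)
  have hlow : 2 / 3 < pulls U X ρ τ a ω / ((τ : ℝ) / K) := by linarith
  have hup : pulls U X ρ τ a ω / ((τ : ℝ) / K) < 4 / 3 := by linarith
  rw [lt_div_iff₀ (by positivity)] at hlow
  rw [div_lt_iff₀ (by positivity)] at hup
  constructor
  · refine le_trans ?_ hlow.le
    rw [← mul_div_assoc, div_le_div_iff₀ (by positivity) hK]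
    nlinarith
  · refine hup.le.trans ?_
    rw [← mul_div_assoc, div_le_div_iff₀ hK (by positivity)]
    nlinarith

variable [MeasurableSpace Ω] {P : Measure Ω} {ν : Measure ℝ} {U : ℕ → IndexRule K} {τ : ℕ → ℕ}

namespace StableAt

theorem comp (hU : ∀ T T', U T = U T') (h : StableAt P U X ρ fun T => T)
    (hτ : Tendsto τ atTop atTop) : StableAt P U X ρ τ := by
  intro a
  obtain ⟨nstar, hconv, hnstar⟩ := h a
  refine ⟨nstar ∘ τ, ?_, hnstar.comp hτ⟩
  simpa only [Function.comp_def, hU (τ _) 0, hU _ 0] using hconv.comp hτ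

-- The centering `n*` of one arm serves all arms, whose counts share one law; as the counts add up
-- to `τ T`, it must be asymptotic to `τ T / K`.
theorem tendstoInMeasure_pulls_div (h : StableAt P U X ρ τ) (henv : IsEnvironment P ν X ρ)
    (hmeas : ∀ T, IsMeasurableRule (U T)) (hsymm : ∀ T, IsSymmetricRule (U T))
    (hτ : ∀ᶠ T in atTop, K ≤ τ T) (a : Fin K) :
    TendstoInMeasure P (fun T ω => pulls (U T) X ρ (τ T) a ω / ((τ T : ℝ) / K)) atTop
      fun _ => (1 : ℝ) := by
  obtain ⟨nstar, hconv, hnstar⟩ := h a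
  refine tendstoInMeasure_iff_dist.2 fun ε hε => ?_
  have hlim := ENNReal.Tendsto.const_mul (a := (K : ℝ≥0∞))
    (tendstoInMeasure_iff_dist.1 hconv (ε / (2 + ε)) (by positivity))
    (Or.inr (ENNReal.natCast_ne_top K))
  rw [mul_zero] at hlim
  refine tendsto_of_tendsto_of_tendsto_of_le_of_le' tendsto_const_nhds hlim
    (Eventually.of_forall fun _ => zero_le) ?_
  filter_upwards [hτ, hnstar.eventually_gt_atTop 0] with T hKτ hpos
  set far : Fin K → Set Ω :=
    fun b => {ω | ε / (2 + ε) ≤ dist (pulls (U T) X ρ (τ T) b ω / nstar T) 1}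
  have hlaw : ∀ b, P (far b) = P (far a) := fun b =>
    (henv.identDistrib_pulls (hmeas T) (hsymm T) hKτ b a).measure_mem_eq
      (s := {n : ℕ | ε / (2 + ε) ≤ dist (n / nstar T) 1}) .of_discrete
  have hsubset : {ω | ε ≤ dist (pulls (U T) X ρ (τ T) a ω / ((τ T : ℝ) / K)) 1} ⊆ ⋃ b, far b := by
    intro ω hω
    by_contra hnear
    simp only [far, Set.mem_iUnion, Set.mem_ofPred_eq, not_exists, not_le] at hnear
    have hsum : ∑ b, (pulls (U T) X ρ (τ T) b ω : ℝ) = τ T := by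
      exact_mod_cast sum_counts (τ T)
    have hdist := dist_div_average_one_lt hε hnear a
    rw [← Finset.sum_div, hsum, Fintype.card_fin, div_right_comm (τ T : ℝ),
      div_div_div_cancel_right₀ hpos.ne'] at hdist
    exact hdist.not_ge hω
  calc P {ω | ε ≤ dist (pulls (U T) X ρ (τ T) a ω / ((τ T : ℝ) / K)) 1}
      ≤ P (⋃ b, far b) := measure_mono hsubset
    _ ≤ ∑ b, P (far b) := measure_iUnion_fintype_le _ _
    _ = K * P (far a) := by simp [hlaw]

theorem tendsto_measure_compl_balancedEvent (h : StableAt P U X ρ fun T => T / (2 * K))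
    (henv : IsEnvironment P ν X ρ) (hmeas : ∀ T, IsMeasurableRule (U T))
    (hsymm : ∀ T, IsSymmetricRule (U T)) :
    Tendsto (fun T => P (balancedEvent (U T) X ρ T)ᶜ) atTop (𝓝 0) := by
  have hK := Nat.pos_of_neZero K
  have hτ := (Nat.tendsto_div_const_atTop (by positivity : 2 * K ≠ 0)).eventually_ge_atTop K
  have hlim := tendsto_finsetSum Finset.univ fun (a : Fin K) _ => tendstoInMeasure_iff_dist.1
    (h.tendstoInMeasure_pulls_div henv hmeas hsymm hτ a) (1 / 3) (by norm_num)
  rw [Finset.sum_const_zero] at hlim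
  refine tendsto_of_tendsto_of_tendsto_of_le_of_le' tendsto_const_nhds hlim
    (Eventually.of_forall fun _ => zero_le) ?_
  filter_upwards [eventually_ge_atTop (8 * K)] with T hT
  refine (measure_mono fun ω hω => ?_).trans (measure_iUnion_fintype_le P _)
  refine by_contra fun hnear => hω (mem_balancedEvent_of_dist_lt hT ?_)
  simpa only [Set.mem_iUnion, Set.mem_ofPred_eq, not_exists, not_le] using hnear

end StableAt

end Stability

section Monopoly

variable {Ω : Type*} {K : ℕ} [NeZero K] {X : Fin K → ℕ → Ω → ℝ} {ρ : ℕ → Ω → Equiv.Perm (Fin K)}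

/-- The event that arm `a` monopolises the play between times `s` and `T`: it is pulled in each of
the rounds `s + 1, …, T`. -/
def monopolyEvent (U : IndexRule K) (X : Fin K → ℕ → Ω → ℝ) (ρ : ℕ → Ω → Equiv.Perm (Fin K))
    (s T : ℕ) (a : Fin K) : Set Ω :=
  {ω | ∀ t, s ≤ t → t < T → arm U X ρ t ω = a}

theorem half_le_dist_of_mem_monopolyEvent (hK : 2 ≤ K) {U : IndexRule K} {T : ℕ} (hT : 0 < T)
    {a : Fin K} {ω : Ω} (hω : ω ∈ monopolyEvent U X ρ (T / (2 * K)) T a) :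
    1 / 2 ≤ dist (pulls U X ρ T a ω / ((T : ℝ) / K)) 1 := by
  have hquarter : T / (2 * K) ≤ T / 4 := Nat.div_le_div_left (by omega) (by norm_num)
  have hpulls : T - T / (2 * K) ≤ pulls U X ρ T a ω := sub_le_counts (Nat.div_le_self _ _) hω
  have hthree : (3 : ℝ) * T ≤ 4 * pulls U X ρ T a ω := by
    exact_mod_cast (by omega : 3 * T ≤ 4 * pulls U X ρ T a ω)
  have hK' : (2 : ℝ) ≤ K := by exact_mod_cast hK
  have : (0 : ℝ) < T := Nat.cast_pos.2 hT
  have hratio : 3 / 2 ≤ pulls U X ρ T a ω / ((T : ℝ) / K) := by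
    rw [le_div_iff₀ (by positivity), ← mul_div_assoc, div_le_iff₀ (by positivity)]
    nlinarith
  exact (by linarith : (1 : ℝ) / 2 ≤ _).trans (le_abs_self _)

theorem mem_monopolyEvent_of_isDominant {U : IndexRule K} {T : ℕ} (hT : 2 * K * K ≤ T)
    {a : Fin K} {β₁ β₂ μ : ℝ} {A : ℕ} (hA : T ≤ A * (T / (4 * K ^ 2))) {ω : Ω}
    (hmono : ∀ t, K ≤ t → t < T → ∀ b, arm U X ρ t ω ≠ b →
      index U X ρ (t + 1) b ω ≤ index U X ρ t b ω)
    (hsand : ∀ t, T / (2 * K) ≤ t → t ≤ T → ∀ b,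
      mean U X ρ t b ω + β₁ / √(pulls U X ρ t b ω) ≤ index U X ρ t b ω ∧
      index U X ρ t b ω ≤ mean U X ρ t b ω + β₂ / √(pulls U X ρ t b ω))
    (hbalanced : ω ∈ balancedEvent U X ρ T)
    (hdom : IsDominant (rewardTable X ω) μ (A * (|β₁| + |β₂| + 1) * √(T / (4 * K ^ 2) : ℕ))
      (T / (4 * K ^ 2)) (A * (T / (4 * K ^ 2))) a) :
    ω ∈ monopolyEvent U X ρ (T / (2 * K)) T a := by
  have hKpos := Nat.pos_of_neZero K
  have hs : K ≤ T / (2 * K) :=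
    (Nat.le_div_iff_mul_le (by positivity)).2 ((mul_comm _ _).trans_le hT)
  have hm : 0 < T / (4 * K ^ 2) := by
    refine Nat.pos_of_ne_zero fun hzero => ?_
    rw [hzero, mul_zero] at hA
    have : 0 < 2 * K * K := by positivity
    omega
  have hcount : ∀ b, T / (4 * K ^ 2) ≤ pulls U X ρ (T / (2 * K)) b ω := fun b => by
    have hfloor : ((T / (4 * K ^ 2) : ℕ) : ℝ) ≤ T / (4 * K ^ 2) := by
      exact_mod_cast (Nat.cast_div_le (α := ℝ) (m := T) (n := 4 * K ^ 2))
    exact_mod_cast hfloor.trans (hbalanced b).1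
  exact fun t => hdom.action_eq hs hm hA hcount (fun t hst => hmono t (hs.trans hst)) hsand

variable [MeasurableSpace Ω] {P : Measure Ω} {ν : Measure ℝ} {U : ℕ → IndexRule K} {β₁ β₂ : ℝ}

theorem StableAt.exists_pos_le_measureReal_monopolyEvent
    (hstable : StableAt P U X ρ fun T => T / (2 * K)) (henv : IsEnvironment P ν X ρ)
    (hvar : 0 < Var[id; ν]) (hmeas : ∀ T, IsMeasurableRule (U T))
    (hsymm : ∀ T, IsSymmetricRule (U T)) (hmono : ∀ T, IndexNonincreasing P (U T) X ρ T)
    (hsand : ∀ T, 0 < T → IndexSandwiched P (U T) X ρ β₁ β₂ T) (a : Fin K) :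
    ∃ p : ℝ, 0 < p ∧ ∀ᶠ T : ℕ in atTop,
      p ≤ P.real (monopolyEvent (U T) X ρ (T / (2 * K)) T a) := by
  have := henv.indep_rank.isProbabilityMeasure
  have hK : 0 < 4 * K ^ 2 := by have := Nat.pos_of_neZero K; positivity
  -- The sample sizes of the arms range between about `T / (4 * K ^ 2)` and `T`; the factor `8`
  -- rather than `4` absorbs the rounding.
  set A := 8 * K ^ 2 with hA
  set μ := ∫ y, y ∂ν
  obtain ⟨p, hp, hdom⟩ :=
    henv.exists_pos_le_measureReal_isDominant hvar (A * (|β₁| + |β₂| + 1)) A a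
  have hbalanced := hstable.tendsto_measure_compl_balancedEvent henv hmeas hsymm
  have hscale := Nat.tendsto_div_const_atTop hK.ne'
  refine ⟨p / 2, half_pos hp, ?_⟩
  filter_upwards [hscale.eventually hdom, hscale.eventually_gt_atTop 0,
    hbalanced.eventually_lt_const (ENNReal.ofReal_pos.2 (half_pos hp)),
    eventually_ge_atTop (2 * K * K), eventually_gt_atTop 0] with T hdomT hm hbalT hTK hT
  have hTA : T ≤ A * (T / (4 * K ^ 2)) := by
    have := (Nat.lt_mul_div_succ T hK).le
    nlinarith
  set dominance := {ω | IsDominant (rewardTable X ω) μ (A * (|β₁| + |β₂| + 1) *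
    √(T / (4 * K ^ 2) : ℕ)) (T / (4 * K ^ 2)) (A * (T / (4 * K ^ 2))) a}
  set monopoly := monopolyEvent (U T) X ρ (T / (2 * K)) T a
  have hsubset : dominance ≤ᵐ[P] (monopoly ∪ (balancedEvent (U T) X ρ T)ᶜ : Set Ω) := by
    filter_upwards [hmono T, hsand T hT] with ω hωmono hωsand hωdom
    by_cases hω : ω ∈ balancedEvent (U T) X ρ T
    · exact Or.inl (mem_monopolyEvent_of_isDominant hTK hTA hωmono (hωsand hω) hω hωdom)
    · exact Or.inr hω
  have hunion : P.real dominance ≤ P.real monopoly + P.real (balancedEvent (U T) X ρ T)ᶜ :=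
    (ENNReal.toReal_mono (measure_ne_top _ _) (measure_mono_ae hsubset)).trans
      (measureReal_union_le _ _)
  have hunbalanced : P.real (balancedEvent (U T) X ρ T)ᶜ < p / 2 :=
    ENNReal.toReal_lt_of_lt_ofReal hbalT
  linarith

theorem not_stableAt_and_stableAt (hK : 2 ≤ K) (henv : IsEnvironment P ν X ρ)
    (hvar : 0 < Var[id; ν]) (hmeas : ∀ T, IsMeasurableRule (U T))
    (hsymm : ∀ T, IsSymmetricRule (U T)) (hmono : ∀ T, IndexNonincreasing P (U T) X ρ T)
    (hsand : ∀ T, 0 < T → IndexSandwiched P (U T) X ρ β₁ β₂ T) :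
    ¬ (StableAt P U X ρ (fun T => T / (2 * K)) ∧ StableAt P U X ρ fun T => T) := by
  rintro ⟨hearly, hlate⟩
  have := henv.indep_rank.isProbabilityMeasure
  obtain ⟨p, hp, hmonopoly⟩ :=
    hearly.exists_pos_le_measureReal_monopolyEvent henv hvar hmeas hsymm hmono hsand 0
  have hcentred := tendstoInMeasure_iff_dist.1 (hlate.tendstoInMeasure_pulls_div henv hmeas hsymm
    (eventually_ge_atTop K) 0) (1 / 2) (by norm_num)
  obtain ⟨T, hpT, hfar, hT⟩ := (hmonopoly.and ((hcentred.eventually_lt_const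
    (ENNReal.ofReal_pos.2 hp)).and (eventually_gt_atTop 0))).exists
  have hp_le := hpT.trans
    (measureReal_mono fun ω hω => half_le_dist_of_mem_monopolyEvent hK hT hω)
  exact hp_le.not_gt (ENNReal.toReal_lt_of_lt_ofReal hfar)

end Monopoly

end Bandit

-- Mathlib's variance is `0` when the second moment is infinite, so `hvar` forces `ν` to have a
-- finite second moment.
theorem theorem1_general {Ω : Type*} [MeasurableSpace Ω] (P : Measure Ω)
    (K : ℕ) [NeZero K] (hK : 2 ≤ K)
    (ν : Measure ℝ)
    (hvar : 0 < Var[fun x : ℝ => x; ν])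
    (X : Fin K → ℕ → Ω → ℝ) (ρ : ℕ → Ω → Equiv.Perm (Fin K))
    (henv : Bandit.IsEnvironment P ν X ρ)
    (U : ℕ → Bandit.IndexRule K)
    (hmeas : ∀ T, Bandit.IsMeasurableRule (U T))
    (hsymm : ∀ T, Bandit.IsSymmetricRule (U T))
    (hmono : ∀ T, Bandit.IndexNonincreasing P (U T) X ρ T)
    (β₁ β₂ : ℝ)
    (hsand : ∀ T, 0 < T → Bandit.IndexSandwiched P (U T) X ρ β₁ β₂ T) :
    ((∀ T T' : ℕ, U T = U T') → ¬ Bandit.StableAt P U X ρ (fun T => T)) ∧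
    ¬ (Bandit.StableAt P U X ρ (fun T => T / (2 * K)) ∧
        Bandit.StableAt P U X ρ (fun T => T)) ∧
    (Bandit.StableAt P U X ρ (fun T => T / (2 * K)) →
      ∀ a : Fin K, ∃ p : ℝ, 0 < p ∧ ∀ᶠ T : ℕ in atTop,
        p ≤ P.real {ω | ∀ t, T / (2 * K) ≤ t → t < T → Bandit.arm (U T) X ρ t ω = a}) := by
  have hboth := Bandit.not_stableAt_and_stableAt hK henv hvar hmeas hsymm hmono hsand
  have hdiv : Tendsto (fun T => T / (2 * K)) atTop atTop :=
    Nat.tendsto_div_const_atTop (by positivity)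
  exact ⟨fun hU hlate => hboth ⟨hlate.comp hU hdiv, hlate⟩, hboth, fun hearly =>
    hearly.exists_pos_le_measureReal_monopolyEvent henv hvar hmeas hsymm hmono hsand⟩

theorem theorem1 {Ω : Type*} [MeasurableSpace Ω] (P : Measure Ω) [IsProbabilityMeasure P]
    (K : ℕ) [NeZero K] (hK : 2 ≤ K)
    (ν : Measure ℝ) [IsProbabilityMeasure ν]
    (hsub : HasSubgaussianMGF (fun x : ℝ => x - ∫ y, y ∂ν) 1 ν)
    (hvar : 0 < Var[fun x : ℝ => x; ν])
    (X : Fin K → ℕ → Ω → ℝ) (ρ : ℕ → Ω → Equiv.Perm (Fin K))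
    (henv : Bandit.IsEnvironment P ν X ρ)
    (U : ℕ → Bandit.IndexRule K)
    (hmeas : ∀ T, Bandit.IsMeasurableRule (U T))
    (hsymm : ∀ T, Bandit.IsSymmetricRule (U T))
    (hmono : ∀ T, Bandit.IndexNonincreasing P (U T) X ρ T)
    (β₁ β₂ : ℝ)
    (hsand : ∀ T, 0 < T → Bandit.IndexSandwiched P (U T) X ρ β₁ β₂ T) :
    ((∀ T T' : ℕ, U T = U T') → ¬ Bandit.StableAt P U X ρ (fun T => T)) ∧
    ¬ (Bandit.StableAt P U X ρ (fun T => T / (2 * K)) ∧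
        Bandit.StableAt P U X ρ (fun T => T)) ∧
    (Bandit.StableAt P U X ρ (fun T => T / (2 * K)) →
      ∀ a : Fin K, ∃ p : ℝ, 0 < p ∧ ∀ᶠ T : ℕ in atTop,
        p ≤ P.real {ω | ∀ t, T / (2 * K) ≤ t → t < T → Bandit.arm (U T) X ρ t ω = a}) :=
  theorem1_general P K hK ν hvar X ρ henv U hmeas hsymm hmono β₁ β₂ hsand
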